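/- All graphs are finite, simple and undirected, with at least one vertex. For a graph $X$ with adjacency matrix $A(X)$, let $U_X(t) = e^{-\mathrm{i} t A(X)}$ for $t \in \mathbb{R}$; we say that $X$ has perfect state transfer if there are two distinct vertices $u \neq v$ of $X$ and a time $t \in \mathbb{R}$ such that the $(v,u)$-entry of $U_X(t)$ has absolute value $1$. The corona $G \circ H$ of graphs $G$ and $H$ is the graph obtained from the disjoint union of $G$ and of one copy $H_v$ of $H$ for each vertex $v$ of $G$ by joining $v$ to every vertex of $H_v$, for each $v \in V(G)$. Let $G$ be (isomorphic to) one of the following graphs: - the $d$-cube $Q_d$ with $d \ge 2$, whose vertices are the binary strings of length $d$, two being adjacent when they differ in exactly one position; - the cocktail party graph $\overline{nK_2}$ with $n \ge 2$, the complement of the disjoint union of $n$ copies of $K_2$; - the halved $2d$-cube $\frac{1}{2}Q_{2d}$ with $d \ge 1$, whose vertices are the binary strings of length $2d$ with an even number of ones, two being adjacent when they differ in exactly two positions. Then, for every regular graph $H$, the corona product $G \circ H$ has no perfect state transfer. -/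

import Mathlib

namespace QuantumWalk

/-- The `d`-cube `Q_d`: binary strings of length `d`, adjacent when they differ in exactly one
position. -/
def hypercube (d : ℕ) : SimpleGraph (Fin d → Bool) where
  Adj x y := hammingDist x y = 1
  symm := ⟨fun x y h => by rwa [hammingDist_comm]⟩
  loopless := ⟨fun x h => by simp [hammingDist_self] at h⟩

/-- The disjoint union `n K₂` of `n` copies of the complete graph on two vertices. -/
def disjointEdges (n : ℕ) : SimpleGraph (Fin n × Fin 2) where
  Adj x y := x.1 = y.1 ∧ (⊤ : SimpleGraph (Fin 2)).Adj x.2 y.2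
  symm := ⟨fun _ _ h => ⟨h.1.symm, h.2.symm⟩⟩
  loopless := ⟨fun _ h => h.2.ne rfl⟩

/-- The cocktail party graph, the complement of `n K₂`. -/
def cocktailParty (n : ℕ) : SimpleGraph (Fin n × Fin 2) := (disjointEdges n)ᶜ

/-- The halved `n`-cube: binary strings of length `n` with an even number of ones, adjacent when
they differ in exactly two positions. -/
def halvedCube (n : ℕ) :
    SimpleGraph {x : Fin n → Bool // Even (hammingDist x fun _ => false)} where
  Adj x y := hammingDist x.1 y.1 = 2
  symm := ⟨fun x y h => by rwa [hammingDist_comm]⟩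
  loopless := ⟨fun x h => by simp [hammingDist_self] at h⟩

/-- The corona `G ∘ H` on `V(G) × ({0} ∪ V(H))`, with `none` in the role of `0`. -/
def corona {V W : Type*} (G : SimpleGraph V) (H : SimpleGraph W) :
    SimpleGraph (V × Option W) where
  Adj
    | (v, none), (v', none) => G.Adj v v'
    | (v, some w), (v', some w') => v = v' ∧ H.Adj w w'
    | (v, none), (v', some _) => v = v'
    | (v, some _), (v', none) => v = v'
  symm := ⟨by
    rintro ⟨v, _ | w⟩ ⟨v', _ | w'⟩ h
    · exact SimpleGraph.Adj.symm (G := G) h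
    · exact Eq.symm h
    · exact Eq.symm h
    · exact ⟨h.1.symm, h.2.symm⟩⟩
  loopless := ⟨by
    rintro ⟨v, _ | w⟩ h
    · exact SimpleGraph.Adj.ne (G := G) h rfl
    · exact h.2.ne rfl⟩

instance coronaDecidableAdj {V W : Type*} (G : SimpleGraph V) (H : SimpleGraph W) [DecidableEq V]
    [DecidableRel G.Adj] [DecidableRel H.Adj] : DecidableRel (corona G H).Adj
  | (v, none), (v', none) => inferInstanceAs (Decidable (G.Adj v v'))
  | (v, some w), (v', some w') => inferInstanceAs (Decidable (v = v' ∧ H.Adj w w'))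
  | (v, none), (v', some _) => inferInstanceAs (Decidable (v = v'))
  | (v, some _), (v', none) => inferInstanceAs (Decidable (v = v'))

/-- The continuous-time quantum walk `U(t) = exp(-i t A(G))`. -/
noncomputable def walk {V : Type*} [Fintype V] [DecidableEq V] (G : SimpleGraph V)
    [DecidableRel G.Adj] (t : ℝ) : Matrix V V ℂ :=
  NormedSpace.exp ((-Complex.I * (t : ℂ)) • G.adjMatrix ℂ)

/-- `G` has perfect state transfer: for some two distinct vertices `u`, `v` and some time `t`,
the `(v, u)` entry of `U(t)` is unimodular. -/
def HasPerfectStateTransfer {V : Type*} [Fintype V] [DecidableEq V] (G : SimpleGraph V)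
    [DecidableRel G.Adj] : Prop :=
  ∃ u v : V, u ≠ v ∧ ∃ t : ℝ, ‖walk G t v u‖ = 1

end QuantumWalk

/-! Under transfer from `u` to `v` with phase γ, an eigenfunction z for θ satisfies e^{-itθ} z(u) =
γ z(v), and likewise with u, v exchanged. Hence e^{-2itθ} = γ² whenever z(u) ≠ 0, so t times any
difference of eigenvalues seen by u lies in πℤ (`exists_int_mul_sub`).

Let H be k-regular on m vertices. An eigenvalue λ of G lifts to the two roots of (θ - k)(θ - λ) = m,
whose gap is √((λ - k)² + 4m). Each base graph has eigenvalues λ ≤ -1 and λ + 2, both seen by every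
vertex: λ = -d for the cube and the halved 2d-cube, λ = -2 for the cocktail party graph. Comparing
the four lifts shows that both discriminants are perfect squares (`isSquare_of_norm_walk_corona`),
which forces λ = -1 and k = 0 (`eq_neg_one_of_isSquare`).

Only K₂ (the halved 2-cube) with H edgeless survives. There the eigenvalues are integers, and the
phases themselves, not only their squares, give the contradiction. -/

/-- `z` is an eigenfunction of the adjacency operator of `X` for `θ` (possibly zero). -/
def SimpleGraph.IsEigenfunction {V : Type*} [Fintype V] (X : SimpleGraph V)
    [DecidableRel X.Adj] (θ : ℝ) (z : V → ℝ) : Prop :=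
  ∀ v, ∑ w, (if X.Adj v w then z w else 0) = θ * z v

theorem SimpleGraph.IsEigenfunction.comp_iso {V V' : Type*} [Fintype V] [Fintype V']
    {X : SimpleGraph V} {Y : SimpleGraph V'} [DecidableRel X.Adj] [DecidableRel Y.Adj]
    {θ : ℝ} {z : V' → ℝ} (hz : Y.IsEigenfunction θ z) (φ : X ≃g Y) :
    X.IsEigenfunction θ (z ∘ φ) := by
  intro v
  rw [Function.comp_apply, ← hz (φ v)]
  refine Fintype.sum_equiv φ.toEquiv _ _ fun w => ?_
  have h : Y.Adj (φ v) (φ w) ↔ X.Adj v w := φ.map_adj_iff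
  by_cases hw : X.Adj v w
  · have := h.2 hw
    simp_all
  · have := mt h.1 hw
    simp_all

open scoped Matrix.Norms.Operator in
theorem Matrix.exp_mulVec_of_mulVec_eq_smul {n : Type*} [Fintype n] [DecidableEq n]
    {A : Matrix n n ℂ} {c : ℂ} {z : n → ℂ} (h : A.mulVec z = c • z) :
    (NormedSpace.exp A).mulVec z = Complex.exp c • z := by
  have hpow : ∀ j : ℕ, (A ^ j).mulVec z = c ^ j • z := by
    intro j
    induction j with
    | zero => simp
    | succ j ih => rw [pow_succ, ← mulVec_mulVec, h, mulVec_smul, ih, smul_smul, pow_succ, mul_comm]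
  have h1 := NormedSpace.exp_series_hasSum_exp' (𝕂 := ℂ) A
  have h2 := h1.map (⟨⟨fun M => M.mulVec z, zero_mulVec z⟩, fun M N => add_mulVec M N z⟩ :
    Matrix n n ℂ →+ (n → ℂ)) (Continuous.matrix_mulVec continuous_id continuous_const)
  have h3 := (NormedSpace.exp_series_hasSum_exp' (𝕂 := ℂ) c).smul_const z
  rw [← Complex.exp_eq_exp_ℂ] at h3
  refine h2.unique ?_
  convert h3 using 2 with j
  simp [smul_mulVec, hpow, smul_smul]

namespace QuantumWalk

/-! ### Perfect state transfer and eigenfunctions -/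

section Walk

open Matrix

variable {V : Type*} [Fintype V] [DecidableEq V] (X : SimpleGraph V) [DecidableRel X.Adj]

theorem walk_symm (t : ℝ) (u v : V) : walk X t u v = walk X t v u := by
  have h : (walk X t)ᵀ = walk X t := by
    rw [walk, ← Matrix.exp_transpose, transpose_smul, SimpleGraph.transpose_adjMatrix]
  exact congrFun (congrFun h v) u

theorem walk_conjTranspose_mul_self (t : ℝ) : (walk X t)ᴴ * walk X t = 1 := by
  have h1 : (walk X t)ᴴ = NormedSpace.exp (-((-Complex.I * (t : ℂ)) • X.adjMatrix ℂ)) := by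
    rw [walk, ← Matrix.exp_conjTranspose, conjTranspose_smul]
    congr 1
    ext i j
    by_cases hij : X.Adj i j <;>
      simp [SimpleGraph.adjMatrix_apply, X.adj_comm j i, hij]
  rw [h1, walk, ← Matrix.exp_add_of_commute _ _
    (Commute.neg_left (Commute.refl ((-Complex.I * (t : ℂ)) • X.adjMatrix ℂ)))]
  simp

variable {X} {t : ℝ} {u v : V}

/-- By unitarity, column `u` has norm 1, and the entry at `v` already exhausts it. -/
theorem walk_apply_eq_zero (h : ‖walk X t v u‖ = 1) {w : V} (hw : w ≠ v) :
    walk X t w u = 0 := by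
  have h1 : ∑ x, ‖walk X t x u‖ ^ 2 = 1 := by
    have := congrFun (congrFun (walk_conjTranspose_mul_self X t) u) u
    simp only [mul_apply, conjTranspose_apply, RCLike.star_def, Complex.conj_mul', one_apply_eq]
      at this
    exact_mod_cast this
  rw [← Finset.add_sum_erase _ _ (Finset.mem_univ v), h, one_pow] at h1
  have h2 : ∑ x ∈ Finset.univ.erase v, ‖walk X t x u‖ ^ 2 = 0 := by linarith
  rw [Finset.sum_eq_zero_iff_of_nonneg fun _ _ => sq_nonneg _] at h2
  simpa using h2 w (by simp [hw])

/-- Under perfect state transfer an eigenfunction is carried from one vertex to the other. -/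
theorem exp_mul_eq_of_norm_walk_eq_one (h : ‖walk X t v u‖ = 1) {θ : ℝ} {z : V → ℝ}
    (hz : X.IsEigenfunction θ z) :
    Complex.exp (-Complex.I * t * θ) * z u = walk X t v u * z v := by
  have hA : ((-Complex.I * (t : ℂ)) • X.adjMatrix ℂ).mulVec (fun w => (z w : ℂ)) =
      (-Complex.I * t * θ) • fun w => (z w : ℂ) := by
    ext w
    have hw := congrArg (fun r : ℝ => (r : ℂ)) (hz w)
    push_cast at hw
    simp only [smul_mulVec, Pi.smul_apply, smul_eq_mul]
    rw [mul_assoc (-Complex.I * (t : ℂ)), ← hw]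
    congr 1
    simp only [mulVec, dotProduct, SimpleGraph.adjMatrix_apply]
    exact Finset.sum_congr rfl fun x _ => by split_ifs <;> simp
  have hU := congrFun (exp_mulVec_of_mulVec_eq_smul hA) u
  change ∑ w, walk X t u w * (z w : ℂ) = Complex.exp (-Complex.I * t * θ) * z u at hU
  rw [← hU, Finset.sum_eq_single v, walk_symm]
  · intro w _ hw
    rw [walk_symm, walk_apply_eq_zero h hw, zero_mul]
  · simp

theorem exp_mul_eq_of_norm_walk_eq_one' (h : ‖walk X t v u‖ = 1) {θ : ℝ} {z : V → ℝ}
    (hz : X.IsEigenfunction θ z) :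
    Complex.exp (-Complex.I * t * θ) * z v = walk X t v u * z u := by
  rw [exp_mul_eq_of_norm_walk_eq_one (u := v) (v := u) (by rwa [walk_symm]) hz, walk_symm]

theorem exp_sq_eq_of_norm_walk_eq_one (h : ‖walk X t v u‖ = 1) {θ : ℝ} {z : V → ℝ}
    (hz : X.IsEigenfunction θ z) (hu : z u ≠ 0) :
    Complex.exp (-Complex.I * t * θ) ^ 2 = walk X t v u ^ 2 := by
  have h1 := exp_mul_eq_of_norm_walk_eq_one h hz
  have h2 := exp_mul_eq_of_norm_walk_eq_one' h hz
  have hu' : (z u : ℂ) ≠ 0 := by exact_mod_cast hu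
  apply mul_right_cancel₀ hu'
  linear_combination Complex.exp (-Complex.I * t * θ) * h1 + walk X t v u * h2

theorem time_ne_zero (huv : u ≠ v) (h : ‖walk X t v u‖ = 1) : t ≠ 0 := by
  rintro rfl
  simp [walk, huv.symm] at h

theorem exists_int_mul_sub (h : ‖walk X t v u‖ = 1) {θ θ' : ℝ} {z z' : V → ℝ}
    (hz : X.IsEigenfunction θ z) (hu : z u ≠ 0) (hz' : X.IsEigenfunction θ' z') (hu' : z' u ≠ 0) :
    ∃ n : ℤ, t * (θ - θ') = n * Real.pi := by
  have h1 := (exp_sq_eq_of_norm_walk_eq_one h hz' hu').trans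
    (exp_sq_eq_of_norm_walk_eq_one h hz hu).symm
  rw [← Complex.exp_nat_mul, ← Complex.exp_nat_mul, Complex.exp_eq_exp_iff_exists_int] at h1
  obtain ⟨n, hn⟩ := h1
  refine ⟨n, ?_⟩
  have h2 : ((t * (θ - θ') : ℝ) : ℂ) = ((n * Real.pi : ℝ) : ℂ) := by
    push_cast
    have : Complex.I * (t * (θ - θ')) = Complex.I * (n * Real.pi : ℂ) := by
      push_cast at hn
      linear_combination hn / 2
    exact mul_left_cancel₀ Complex.I_ne_zero this
  exact_mod_cast h2

end Walk

/-! ### Spectrum of the corona and the ratio condition -/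

section Corona

variable {V W : Type*} [Fintype V] [DecidableEq V] [Fintype W]
  {G : SimpleGraph V} [DecidableRel G.Adj] {H : SimpleGraph W} [DecidableRel H.Adj]

theorem sum_ite_corona_adj_none (f : V × Option W → ℝ) (v : V) :
    ∑ x, (if (corona G H).Adj (v, none) x then f x else 0) =
      ∑ x, (if G.Adj v x then f (x, none) else 0) + ∑ w, f (v, some w) := by
  simp only [Fintype.sum_prod_type, Fintype.sum_option, Finset.sum_add_distrib]
  congr 1
  rw [Finset.sum_eq_single v]
  · exact Finset.sum_congr rfl fun w _ => if_pos (rfl : v = v)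
  · exact fun x _ hx => Finset.sum_eq_zero fun w _ => if_neg (Ne.symm hx)
  · simp

theorem sum_ite_corona_adj_some (f : V × Option W → ℝ) (v : V) (w : W) :
    ∑ x, (if (corona G H).Adj (v, some w) x then f x else 0) =
      f (v, none) + ∑ w', (if H.Adj w w' then f (v, some w') else 0) := by
  simp only [Fintype.sum_prod_type, Fintype.sum_option, Finset.sum_add_distrib]
  congr 1
  · rw [Finset.sum_eq_single v]
    · exact if_pos (rfl : v = v)
    · exact fun x _ hx => if_neg (Ne.symm hx)
    · simp
  · rw [Finset.sum_eq_single v]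
    · exact Finset.sum_congr rfl fun x _ => if_congr ⟨fun h => h.2, fun h => ⟨rfl, h⟩⟩ rfl rfl
    · exact fun x _ hx => Finset.sum_eq_zero fun w _ => if_neg fun h => hx h.1.symm
    · simp

/-- The function on the corona built from a function on the base graph, scaled on the base. -/
def coronaLift (W : Type*) {V : Type*} (c : ℝ) (z : V → ℝ) : V × Option W → ℝ
  | (v, none) => c * z v
  | (v, some _) => z v

theorem coronaLift_ne_zero {V W : Type*} {c : ℝ} (hc : c ≠ 0) {z : V → ℝ} {x : V × Option W}
    (hx : z x.1 ≠ 0) : coronaLift W c z x ≠ 0 := by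
  obtain ⟨v, _ | w⟩ := x
  · exact mul_ne_zero hc hx
  · exact hx

/-- The scale θ - k is what the equation at a vertex of H requires; the equation at a base vertex is
then the quadratic `hθ`. -/
theorem isEigenfunction_coronaLift {k : ℕ} (hH : H.IsRegularOfDegree k) {lam θ : ℝ} {z : V → ℝ}
    (hz : G.IsEigenfunction lam z) (hθ : (θ - k) * (θ - lam) = Fintype.card W) :
    (corona G H).IsEigenfunction θ (coronaLift W (θ - k) z) := by
  rintro ⟨v, _ | w⟩
  · rw [sum_ite_corona_adj_none]
    simp only [coronaLift, Finset.sum_const, Finset.card_univ, nsmul_eq_mul]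
    have h1 : ∑ x, (if G.Adj v x then (θ - k) * z x else 0) = (θ - k) * (lam * z v) := by
      rw [← hz v, Finset.mul_sum]
      exact Finset.sum_congr rfl fun x _ => by split_ifs <;> simp
    rw [h1, ← hθ]
    ring
  · rw [sum_ite_corona_adj_some]
    have h2 : ∑ w', (if H.Adj w w' then z v else 0) = k * z v := by
      simp [← Finset.sum_filter, ← hH w, ← SimpleGraph.card_neighborFinset_eq_degree,
        SimpleGraph.neighborFinset_eq_filter]
    simp only [coronaLift]
    rw [h2]
    ring

/-- If the ratio condition makes `√N` commensurable with a nonzero integer, `N` is a square. -/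
theorem isSquare_of_commensurable {N : ℤ} (hN : 0 ≤ N) {t : ℝ} (ht : t ≠ 0) {a b : ℤ}
    (ha : t * 2 = a * Real.pi) (hb : t * √(N : ℝ) = b * Real.pi) : IsSquare N := by
  by_contra hsq
  have hirr := (irrational_sqrt_intCast_iff_of_nonneg hN).2 hsq
  have ha0 : (a : ℝ) ≠ 0 := by
    rintro h
    rw [h] at ha
    simp_all
  apply hirr
  refine ⟨2 * b / a, ?_⟩
  push_cast
  rw [div_eq_iff ha0]
  apply mul_left_cancel₀ (mul_ne_zero ht Real.pi_ne_zero)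
  linear_combination -(t * 2) * hb + t * √(N : ℝ) * ha

/-- Two squares of the form `x ^ 2 + 4 m`, `(x + 2) ^ 2 + 4 m` force `x = -1`. -/
theorem eq_neg_one_of_isSquare {x m : ℤ} (hm : 0 < m) (hx : x ≤ -1)
    (h1 : IsSquare (x ^ 2 + 4 * m)) (h2 : IsSquare ((x + 2) ^ 2 + 4 * m)) : x = -1 := by
  by_contra hne
  have hx2 : x ≤ -2 := by omega
  obtain ⟨p, hp⟩ := h1
  obtain ⟨q, hq⟩ := h2
  wlog hp0 : 0 ≤ p generalizing p
  · exact this (-p) (by rw [hp]; ring) (by omega)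
  wlog hq0 : 0 ≤ q generalizing q
  · exact this (-q) (by rw [hq]; ring) (by omega)
  have hlt : q < p := by nlinarith
  have hpar : (p - q) % 2 = 0 := by
    have h3 : (p - q) * (p + q) = 2 * (2 * (-x - 1)) := by linear_combination hq - hp
    rcases Int.emod_two_eq_zero_or_one (p - q) with h | h
    · exact h
    · exfalso
      have h4 : (p + q) % 2 = 1 := by omega
      have := congrArg (· % 2) h3
      simp [Int.mul_emod, h, h4] at this
  -- Then p² - q² = -4x - 4 gives q ≤ -x - 2, against q² > (x + 2)².
  have h5 : q + 2 ≤ p := by omega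
  have h6 : q ≤ -x - 2 := by nlinarith
  nlinarith

theorem corona_eigenvalue_plus {l k m : ℝ} (h : 0 ≤ (l - k) ^ 2 + 4 * m) :
    ((l + k + √((l - k) ^ 2 + 4 * m)) / 2 - k) * ((l + k + √((l - k) ^ 2 + 4 * m)) / 2 - l) = m := by
  have := Real.sq_sqrt h
  linear_combination this / 4

theorem corona_eigenvalue_minus {l k m : ℝ} (h : 0 ≤ (l - k) ^ 2 + 4 * m) :
    ((l + k - √((l - k) ^ 2 + 4 * m)) / 2 - k) * ((l + k - √((l - k) ^ 2 + 4 * m)) / 2 - l) = m := by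
  have := Real.sq_sqrt h
  linear_combination this / 4

variable [DecidableEq W]

theorem isSquare_of_norm_walk_corona [Nonempty W] {k : ℕ} (hH : H.IsRegularOfDegree k)
    {lam : ℤ} {z z' : V → ℝ} (hz : G.IsEigenfunction (lam : ℝ) z)
    (hz' : G.IsEigenfunction (lam + 2 : ℝ) z') {u v : V × Option W} (huv : u ≠ v) {t : ℝ}
    (h : ‖walk (corona G H) t v u‖ = 1) (hu : z u.1 ≠ 0) (hu' : z' u.1 ≠ 0) :
    IsSquare ((lam - k) ^ 2 + 4 * (Fintype.card W : ℤ)) ∧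
      IsSquare ((lam - k + 2) ^ 2 + 4 * (Fintype.card W : ℤ)) := by
  have hm : (0 : ℝ) < Fintype.card W := by exact_mod_cast Fintype.card_pos
  have ht := time_ne_zero huv h
  have hn1 : (0 : ℝ) ≤ (lam - k) ^ 2 + 4 * (Fintype.card W : ℝ) := by positivity
  have hn2 : (0 : ℝ) ≤ (lam + 2 - k) ^ 2 + 4 * (Fintype.card W : ℝ) := by positivity
  have key : ∀ {l θ : ℝ} {y : V → ℝ}, G.IsEigenfunction l y → y u.1 ≠ 0 →
      (θ - k) * (θ - l) = Fintype.card W →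
      (corona G H).IsEigenfunction θ (coronaLift W (θ - k) y) ∧
        coronaLift W (θ - k) y u ≠ 0 := by
    -- Since m > 0, no root θ equals k, so the lift does not vanish at base vertices either.
    intro l θ y hy hyu hθ
    refine ⟨isEigenfunction_coronaLift hH hy hθ, coronaLift_ne_zero ?_ hyu⟩
    intro h0
    rw [h0, zero_mul] at hθ
    exact hm.ne hθ
  obtain ⟨e1, n1⟩ := key hz hu (corona_eigenvalue_plus hn1)
  obtain ⟨e2, n2⟩ := key hz hu (corona_eigenvalue_minus hn1)
  obtain ⟨e3, n3⟩ := key hz' hu' (corona_eigenvalue_plus hn2)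
  obtain ⟨e4, n4⟩ := key hz' hu' (corona_eigenvalue_minus hn2)
  obtain ⟨b, hb⟩ := exists_int_mul_sub h e1 n1 e2 n2
  obtain ⟨c, hc⟩ := exists_int_mul_sub h e3 n3 e4 n4
  obtain ⟨d, hd⟩ := exists_int_mul_sub h e3 n3 e1 n1
  obtain ⟨e, he⟩ := exists_int_mul_sub h e4 n4 e2 n2
  -- The two roots over λ sum to λ + k, so the root sums over λ + 2 and λ differ by exactly 2.
  have h2 : t * 2 = ((d + e : ℤ) : ℝ) * Real.pi := by
    push_cast
    linear_combination hd + he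
  constructor
  · refine isSquare_of_commensurable (by positivity) ht h2 (b := b) ?_
    push_cast
    linear_combination hb
  · refine isSquare_of_commensurable (by positivity) ht h2 (b := c) ?_
    rw [show (((lam - k + 2) ^ 2 + 4 * (Fintype.card W : ℤ) : ℤ) : ℝ) =
      (lam + 2 - k) ^ 2 + 4 * (Fintype.card W : ℝ) by push_cast; ring]
    linear_combination hc

theorem eq_neg_one_of_hasPerfectStateTransfer_corona [Nonempty W] {k : ℕ}
    (hH : H.IsRegularOfDegree k) {lam : ℤ} (hlam : lam ≤ -1)
    (hG : ∀ a : V, ∃ z z' : V → ℝ, G.IsEigenfunction (lam : ℝ) z ∧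
      G.IsEigenfunction (lam + 2 : ℝ) z' ∧ z a ≠ 0 ∧ z' a ≠ 0)
    (h : HasPerfectStateTransfer (corona G H)) : lam = -1 ∧ k = 0 := by
  obtain ⟨u, v, huv, t, ht⟩ := h
  obtain ⟨z, z', hz, hz', hu, hu'⟩ := hG u.1
  obtain ⟨h1, h2⟩ := isSquare_of_norm_walk_corona hH hz hz' huv ht hu hu'
  have hm : (0 : ℤ) < Fintype.card W := by exact_mod_cast Fintype.card_pos
  have := eq_neg_one_of_isSquare hm (by omega) h1 h2
  omega

/-- Lifts are constant on each copy of H; this eigenfunction separates two vertices of one copy. -/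
theorem isEigenfunction_corona_pair {k : ℕ} (hH : H.IsRegularOfDegree k) (hk : k = 0) (a : V)
    {w w' : W} (hw : w ≠ w') :
    (corona G H).IsEigenfunction 0
      (fun x => if x = (a, some w) then 1 else if x = (a, some w') then -1 else 0) := by
  have hno : ∀ x y, ¬ H.Adj x y := by
    intro x y hxy
    have h1 := hH x
    rw [hk, ← SimpleGraph.card_neighborFinset_eq_degree, Finset.card_eq_zero] at h1
    have : y ∈ H.neighborFinset x := by simpa using hxy
    simp [h1] at this
  rintro ⟨v, _ | x⟩
  · rw [sum_ite_corona_adj_none]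
    by_cases hv : v = a
    · have : ∀ y : W, (if y = w then (1 : ℝ) else if y = w' then -1 else 0) =
          (if y = w then 1 else 0) - (if y = w' then 1 else 0) := by
        intro y
        by_cases h1 : y = w
        · simp [h1, hw]
        · by_cases h2 : y = w' <;> simp [h2, hw.symm]
      simp [hv, this]
    · simp [hv]
  · rw [sum_ite_corona_adj_some]
    simp [hno]

/-- The one case in which the ratio condition may hold: the base is `K₂` and `H` is empty. -/
theorem not_hasPerfectStateTransfer_corona_of_degree_zero [Nonempty W] {k : ℕ}
    (hH : H.IsRegularOfDegree k) (hk : k = 0) {z : V → ℝ} (hz : G.IsEigenfunction (-1) z)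
    (hz' : G.IsEigenfunction 1 fun _ => 1) (hinj : Function.Injective z) (hz0 : ∀ a, z a ≠ 0) :
    ¬ HasPerfectStateTransfer (corona G H) := by
  rintro ⟨u, v, huv, t, h⟩
  have hm : (0 : ℤ) < Fintype.card W := by exact_mod_cast Fintype.card_pos
  obtain ⟨h1, -⟩ := isSquare_of_norm_walk_corona (lam := -1) hH (by simpa using hz)
    (by norm_num; exact hz') huv h (hz0 _) one_ne_zero
  obtain ⟨s, hs⟩ := h1
  have hks : (k : ℝ) = 0 := by exact_mod_cast hk
  wlog hs0 : 0 ≤ s generalizing s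
  · exact this (-s) (by rw [hs]; ring) (by omega)
  simp only [hk] at hs
  -- Here s² = 1 + 4m, so s = 2a + 1 and m = a(a + 1). The lifts of 1 are a + 1 and -a; one lift of
  -- -1 is a.
  obtain ⟨a, rfl | rfl⟩ : ∃ a : ℤ, s = 2 * a ∨ s = 2 * a + 1 := ⟨s / 2, by omega⟩
  · push_cast at hs
    ring_nf at hs
    omega
  have ha : 1 ≤ a := by
    push_cast at hs
    nlinarith
  have hma : (Fintype.card W : ℝ) = a * (a + 1) := by
    have : (Fintype.card W : ℤ) = a * (a + 1) := by
      push_cast at hs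
      linarith
    exact_mod_cast this
  have ha' : (1 : ℝ) ≤ a := by exact_mod_cast ha
  have e1 := isEigenfunction_coronaLift (θ := a + 1) hH hz' (by rw [hma, hks]; ring)
  have e2 := isEigenfunction_coronaLift (θ := -a) hH hz' (by rw [hma, hks]; ring)
  have e3 := isEigenfunction_coronaLift (θ := a) hH hz (by rw [hma, hks]; ring)
  rw [hks] at e1 e2 e3
  have s1 := exp_sq_eq_of_norm_walk_eq_one h e1 (coronaLift_ne_zero (by linarith) one_ne_zero)
  have s3 := exp_sq_eq_of_norm_walk_eq_one h e3 (coronaLift_ne_zero (by linarith) (hz0 _))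
  have p1 := exp_mul_eq_of_norm_walk_eq_one h e1
  have p2 := exp_mul_eq_of_norm_walk_eq_one h e2
  have p3 := exp_mul_eq_of_norm_walk_eq_one h e3
  have hexp : ∀ n : ℤ, Complex.exp (-Complex.I * t * ((n : ℝ) : ℂ)) =
      Complex.exp (-Complex.I * t) ^ n := by
    intro n
    rw [← Complex.exp_int_mul]
    congr 1
    push_cast
    ring
  set ω := Complex.exp (-Complex.I * t) with hω
  have hω0 : ω ≠ 0 := Complex.exp_ne_zero _
  set γ := walk (corona G H) t v u with hγ
  rw [show ((a : ℝ) + 1) = ((a + 1 : ℤ) : ℝ) by push_cast; rfl, hexp] at s1 p1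
  rw [show (-(a : ℝ)) = ((-a : ℤ) : ℝ) by push_cast; rfl, hexp] at p2
  rw [hexp] at s3 p3
  -- The eigenvalues a + 1 and a differ by 1.
  have hω2 : ω ^ 2 = 1 := by
    have h3 : (ω ^ a) ^ 2 ≠ 0 := pow_ne_zero _ (zpow_ne_zero _ hω0)
    rw [zpow_add_one₀ hω0, mul_pow, ← s3] at s1
    exact mul_left_cancel₀ h3 (by rw [s1, mul_one])
  -- The exponents a + 1 and -a differ by an odd number, while ω² = 1.
  have hfin : ω ^ (a + 1) = γ → ω ^ (-a) = γ → ω = 1 ∧ γ = 1 := by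
    intro q1 q2
    have h4 : ω ^ (2 * a + 1) = 1 := by
      rw [show 2 * a + 1 = (a + 1) - (-a) by ring, zpow_sub₀ hω0, q1, q2, div_self]
      rw [← q1]
      exact zpow_ne_zero _ hω0
    rw [zpow_add_one₀ hω0, zpow_mul, show ω ^ (2 : ℤ) = 1 by exact_mod_cast hω2, one_zpow,
      one_mul] at h4
    exact ⟨h4, by rw [← q1, h4, one_zpow]⟩
  have hnorm : ∀ n : ℤ, ‖ω ^ n‖ = 1 := by
    intro n
    have : ‖ω‖ = 1 := by
      rw [hω, Complex.norm_exp]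
      simp
    rw [norm_zpow, this, one_zpow]
  obtain ⟨b, x⟩ := u
  obtain ⟨b', y⟩ := v
  rcases x with _ | x <;> rcases y with _ | y
  · simp only [coronaLift, sub_zero, mul_one] at p1 p2 p3
    have c1 : (((a + 1 : ℤ) : ℝ) : ℂ) ≠ 0 := by
      have : (a + 1 : ℤ) ≠ 0 := by omega
      exact_mod_cast this
    have c2 : (((-a : ℤ) : ℝ) : ℂ) ≠ 0 := by
      have : (-a : ℤ) ≠ 0 := by omega
      exact_mod_cast this
    obtain ⟨q1, q2⟩ := hfin (mul_right_cancel₀ c1 p1) (mul_right_cancel₀ c2 p2)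
    rw [q1, q2, one_zpow, one_mul, one_mul] at p3
    have hbb : a * z b = a * z b' := by exact_mod_cast p3
    exact huv (by rw [hinj (mul_left_cancel₀ (by linarith) hbb)])
  -- Between a base vertex and a vertex of H, moduli would give a + 1 = 1.
  · simp only [coronaLift, sub_zero, mul_one] at p1
    have := congrArg norm p1
    simp only [norm_mul, hnorm, h, one_mul, Complex.norm_real, Real.norm_eq_abs, abs_one] at this
    push_cast at this
    rw [abs_of_nonneg (by linarith)] at this
    linarith
  · simp only [coronaLift, sub_zero, mul_one] at p1
    have := congrArg norm p1
    simp only [norm_mul, hnorm, h, one_mul, Complex.norm_real, Real.norm_eq_abs, abs_one] at this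
    push_cast at this
    rw [abs_of_nonneg (by linarith)] at this
    simp at this
    linarith
  · simp only [coronaLift, Complex.ofReal_one, mul_one] at p1 p2 p3
    obtain ⟨q1, q2⟩ := hfin p1 p2
    rw [q1, q2, one_zpow, one_mul, one_mul] at p3
    obtain rfl := hinj (Complex.ofReal_injective p3)
    have hxy : x ≠ y := by
      rintro rfl
      exact huv rfl
    have p4 := exp_mul_eq_of_norm_walk_eq_one h (isEigenfunction_corona_pair (G := G) hH hk b hxy)
    rw [← hγ, q2] at p4
    simp [hxy.symm] at p4
    norm_num at p4

end Corona

end QuantumWalk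

namespace QuantumWalk

/-! ### Characters of binary strings: cubes and halved cubes -/

section Character

variable {n : ℕ}

/-- The multiplicative function on binary strings with value `s i` at the `i`-th unit string. -/
def stringCharacter (s : Fin n → ℝ) (x : Fin n → Bool) : ℝ := ∏ i, if x i then s i else 1

theorem stringCharacter_ne_zero {s : Fin n → ℝ} (hs : ∀ i, s i ^ 2 = 1) (x : Fin n → Bool) :
    stringCharacter s x ≠ 0 := by
  refine Finset.prod_ne_zero_iff.2 fun i _ => ?_
  have := hs i
  split_ifs
  · intro h
    simp [h] at this
  · exact one_ne_zero

/-- The strings at distance j from x are x with a j-set T flipped, and a flip on T multiplies a ±1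
character by its value on T. -/
theorem sum_hammingDist_eq_stringCharacter {s : Fin n → ℝ} (hs : ∀ i, s i ^ 2 = 1) (j : ℕ)
    (x : Fin n → Bool) :
    ∑ y, (if hammingDist x y = j then stringCharacter s y else 0) =
      (∑ T ∈ Finset.powersetCard j Finset.univ, ∏ i ∈ T, s i) * stringCharacter s x := by
  rw [Finset.powersetCard_eq_filter, Finset.sum_filter, Finset.powerset_univ, Finset.sum_mul]
  symm
  refine Finset.sum_bij' (fun T _ i => xor (x i) (decide (i ∈ T)))
    (fun y _ => Finset.univ.filter fun i => x i ≠ y i) (by simp) (by simp) ?_ ?_ ?_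
  · intro T _
    ext i
    cases hx : x i <;> simp [hx]
  · intro y _
    ext i
    cases hx : x i <;> cases hy : y i <;> simp [hx, hy]
  · intro T _
    have hd : hammingDist x (fun i => xor (x i) (decide (i ∈ T))) = T.card := by
      unfold hammingDist
      congr 1
      ext i
      cases hx : x i <;> simp [hx]
    rw [hd, ite_mul, zero_mul]
    congr 1
    rw [stringCharacter, stringCharacter, ← Finset.prod_ite_mem_eq, ← Finset.prod_mul_distrib]
    refine Finset.prod_congr rfl fun i _ => ?_
    have := hs i
    by_cases hi : i ∈ T <;> cases x i <;> simp [hi]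
    linarith

theorem two_mul_sum_powersetCard_two {ι : Type*} [DecidableEq ι] (s : ι → ℝ) (S : Finset ι) :
    2 * ∑ T ∈ Finset.powersetCard 2 S, ∏ i ∈ T, s i = (∑ i ∈ S, s i) ^ 2 - ∑ i ∈ S, s i ^ 2 := by
  induction S using Finset.induction_on with
  | empty => simp [Finset.powersetCard_eq_empty.2 (show (∅ : Finset ι).card < 2 by simp)]
  | insert a S ha ih =>
    rw [Finset.powersetCard_succ_insert ha, Finset.sum_union, Finset.sum_image, mul_add, ih,
      Finset.powersetCard_one, Finset.sum_map, Finset.sum_insert ha, Finset.sum_insert ha]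
    · have : ∑ x ∈ S, ∏ i ∈ insert a ({x} : Finset ι), s i = s a * ∑ i ∈ S, s i := by
        rw [Finset.mul_sum]
        refine Finset.sum_congr rfl fun x hx => ?_
        rw [Finset.prod_insert (by simpa using fun h : a = x => ha (h ▸ hx)),
          Finset.prod_singleton]
      simp only [Function.Embedding.coeFn_mk]
      rw [this]
      ring
    · intro T hT T' hT' h
      have h1 : a ∉ T := fun h => ha ((Finset.mem_powersetCard.1 hT).1 h)
      have h2 : a ∉ T' := fun h => ha ((Finset.mem_powersetCard.1 hT').1 h)
      rw [← Finset.erase_insert h1, ← Finset.erase_insert h2, h]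
    · rw [Finset.disjoint_left]
      intro T hT hT'
      obtain ⟨T', -, rfl⟩ := Finset.mem_image.1 hT'
      exact ha ((Finset.mem_powersetCard.1 hT).1 (Finset.mem_insert_self _ _))

theorem neg_one_pow_hammingDist (x y : Fin n → Bool) :
    (-1 : ℤ) ^ hammingDist x y =
      (∏ i, if x i then -1 else 1) * ∏ i, if y i then -1 else 1 := by
  rw [hammingDist, ← Finset.prod_const, Finset.prod_filter, ← Finset.prod_mul_distrib]
  refine Finset.prod_congr rfl fun i _ => ?_
  cases x i <;> cases y i <;> simp

theorem even_hammingDist_of_even {x y z : Fin n → Bool} (hx : Even (hammingDist x z))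
    (hxy : Even (hammingDist x y)) : Even (hammingDist y z) := by
  rw [← neg_one_pow_eq_one_iff_even (R := ℤ) (by norm_num)] at *
  rw [neg_one_pow_hammingDist] at *
  have : (∏ i, if x i then (-1 : ℤ) else 1) ^ 2 = 1 := by
    rw [← Finset.prod_pow]
    exact Finset.prod_eq_one fun i _ => by split_ifs <;> norm_num
  linear_combination (∏ i, if x i then (-1 : ℤ) else 1) * (∏ i, if z i then (-1 : ℤ) else 1) * hxy
    + hx - (∏ i, if y i then (-1 : ℤ) else 1) * (∏ i, if z i then (-1 : ℤ) else 1) * this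

theorem isEigenfunction_hypercube [DecidableRel (hypercube n).Adj] {s : Fin n → ℝ}
    (hs : ∀ i, s i ^ 2 = 1) :
    (hypercube n).IsEigenfunction (∑ i, s i) (stringCharacter s) := by
  intro x
  have h := sum_hammingDist_eq_stringCharacter hs 1 x
  rw [Finset.powersetCard_one, Finset.sum_map] at h
  simp only [Function.Embedding.coeFn_mk, Finset.prod_singleton] at h
  rw [← h]
  exact Finset.sum_congr rfl fun y _ => if_congr Iff.rfl rfl rfl

theorem isEigenfunction_halvedCube [DecidableRel (halvedCube n).Adj] {s : Fin n → ℝ}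
    (hs : ∀ i, s i ^ 2 = 1) :
    (halvedCube n).IsEigenfunction (((∑ i, s i) ^ 2 - n) / 2) fun x => stringCharacter s x.1 := by
  rintro ⟨x, hx⟩
  have h := sum_hammingDist_eq_stringCharacter hs 2 x
  have h2 := two_mul_sum_powersetCard_two s Finset.univ
  simp only [hs, Finset.sum_const, Finset.card_univ, Fintype.card_fin, nsmul_eq_mul, mul_one] at h2
  rw [← h2, mul_div_cancel_left₀ _ two_ne_zero]
  refine Eq.trans ?_ h
  -- Strings of odd weight contribute nothing: distance two preserves parity.
  rw [← Finset.sum_filter_add_sum_filter_not Finset.univ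
    (fun y : Fin n → Bool => Even (hammingDist y fun _ => false))]
  rw [Finset.sum_eq_zero (s := Finset.univ.filter fun y : Fin n → Bool =>
    ¬ Even (hammingDist y fun _ => false)), add_zero]
  · rw [Finset.sum_subtype (p := fun y : Fin n → Bool => Even (hammingDist y fun _ => false))]
    · exact Finset.sum_congr rfl fun y _ => if_congr Iff.rfl rfl rfl
    · simp
  · intro y hy
    refine if_neg fun h => (Finset.mem_filter.1 hy).2 (even_hammingDist_of_even hx ?_)
    rw [h]
    exact even_two

/-- The signs that are `-1` in the first `c` places and `1` in the others. -/
def initialSign (n c : ℕ) (i : Fin n) : ℝ := if (i : ℕ) < c then -1 else 1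

theorem initialSign_sq (c : ℕ) (i : Fin n) : initialSign n c i ^ 2 = 1 := by
  unfold initialSign
  split_ifs <;> norm_num

theorem sum_initialSign {c : ℕ} (hc : c ≤ n) : ∑ i, initialSign n c i = n - 2 * c := by
  have h : ∀ i, initialSign n c i = 1 - 2 * (if (i : ℕ) < c then 1 else 0) := by
    intro i
    unfold initialSign
    split_ifs <;> norm_num
  simp only [h, Finset.sum_sub_distrib, ← Finset.mul_sum]
  rw [Finset.sum_boole, Fin.card_filter_val_lt, min_eq_right hc]
  simp

end Character

/-! ### Cocktail party graphs and the required eigenvalue pairs -/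

theorem isEigenfunction_cocktailParty_zero {n : ℕ} [DecidableRel (cocktailParty n).Adj] :
    (cocktailParty n).IsEigenfunction 0 fun x => if x.2 = 0 then 1 else -1 := by
  rintro ⟨i, b⟩
  rw [Fintype.sum_prod_type, zero_mul]
  refine Finset.sum_eq_zero fun j _ => ?_
  rw [Fin.sum_univ_two]
  by_cases h : i = j
  · subst h
    fin_cases b <;> simp [cocktailParty, disjointEdges]
  · simp [cocktailParty, disjointEdges, h]

theorem isEigenfunction_cocktailParty_neg_two {n : ℕ} [DecidableRel (cocktailParty n).Adj]
    {f : Fin n → ℝ} (hf : ∑ i, f i = 0) :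
    (cocktailParty n).IsEigenfunction (-2) fun x => f x.1 := by
  rintro ⟨i, b⟩
  rw [Fintype.sum_prod_type]
  have h : ∀ j, ∑ c, (if (cocktailParty n).Adj (i, b) (j, c) then f j else 0) =
      2 * f j - (if i = j then 2 * f j else 0) := by
    intro j
    rw [Fin.sum_univ_two]
    by_cases h : i = j
    · subst h
      fin_cases b <;> simp [cocktailParty, disjointEdges]
    · simp [cocktailParty, disjointEdges, h]
      ring
  simp only [h, Finset.sum_sub_distrib, ← Finset.mul_sum, hf]
  simp

theorem exists_isEigenfunction_hypercube {d : ℕ} [DecidableRel (hypercube d).Adj] (hd : 1 ≤ d)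
    (a : Fin d → Bool) :
    ∃ z z' : (Fin d → Bool) → ℝ, (hypercube d).IsEigenfunction ((-d : ℤ) : ℝ) z ∧
      (hypercube d).IsEigenfunction (((-d : ℤ) : ℝ) + 2) z' ∧ z a ≠ 0 ∧ z' a ≠ 0 := by
  refine ⟨_, _, ?_, ?_, stringCharacter_ne_zero (initialSign_sq d) a,
    stringCharacter_ne_zero (initialSign_sq (d - 1)) a⟩
  · convert isEigenfunction_hypercube (n := d) (initialSign_sq d) using 1
    rw [sum_initialSign le_rfl]
    push_cast
    ring
  · convert isEigenfunction_hypercube (n := d) (initialSign_sq (d - 1)) using 1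
    rw [sum_initialSign (Nat.sub_le _ _)]
    push_cast [hd]
    ring

theorem exists_isEigenfunction_halvedCube {d : ℕ} [DecidableRel (halvedCube (2 * d)).Adj]
    (hd : 1 ≤ d) (a : {x : Fin (2 * d) → Bool // Even (hammingDist x fun _ => false)}) :
    ∃ z z' : {x : Fin (2 * d) → Bool // Even (hammingDist x fun _ => false)} → ℝ,
      (halvedCube (2 * d)).IsEigenfunction ((-d : ℤ) : ℝ) z ∧
      (halvedCube (2 * d)).IsEigenfunction (((-d : ℤ) : ℝ) + 2) z' ∧ z a ≠ 0 ∧ z' a ≠ 0 := by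
  -- Sign sums 0 and 2 give eigenvalues (0 - 2d)/2 = -d and (4 - 2d)/2 = -d + 2.
  refine ⟨fun x => stringCharacter (initialSign _ d) x.1,
    fun x => stringCharacter (initialSign _ (d - 1)) x.1, ?_, ?_,
    stringCharacter_ne_zero (initialSign_sq d) a.1,
    stringCharacter_ne_zero (initialSign_sq (d - 1)) a.1⟩
  · convert isEigenfunction_halvedCube (n := 2 * d) (initialSign_sq d) using 1
    rw [sum_initialSign (by omega)]
    push_cast
    ring
  · convert isEigenfunction_halvedCube (n := 2 * d) (initialSign_sq (d - 1)) using 1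
    rw [sum_initialSign (by omega)]
    push_cast [hd]
    ring

theorem exists_isEigenfunction_halvedCube_two [DecidableRel (halvedCube (2 * 1)).Adj] :
    ∃ z : {x : Fin (2 * 1) → Bool // Even (hammingDist x fun _ => false)} → ℝ,
      (halvedCube (2 * 1)).IsEigenfunction (-1) z ∧
      (halvedCube (2 * 1)).IsEigenfunction 1 (fun _ => 1) ∧
      Function.Injective z ∧ ∀ a, z a ≠ 0 := by
  refine ⟨fun x => stringCharacter (initialSign (2 * 1) 1) x.1, ?_, ?_, ?_,
    fun a => stringCharacter_ne_zero (initialSign_sq 1) a.1⟩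
  · convert isEigenfunction_halvedCube (n := 2 * 1) (initialSign_sq 1) using 1
    rw [sum_initialSign (by omega)]
    norm_num
  · convert isEigenfunction_halvedCube (n := 2 * 1) (initialSign_sq (n := 2 * 1) 0) using 1
    · rw [sum_initialSign (by omega)]
      norm_num
    · ext x
      simp [stringCharacter, initialSign]
  · have key : ∀ x y : {x : Fin (2 * 1) → Bool // Even (hammingDist x fun _ => false)},
        x.1 0 = y.1 0 → x = y := by decide
    intro x y hxy
    apply key
    have hval : ∀ b : Fin (2 * 1) → Bool,
        stringCharacter (initialSign (2 * 1) 1) b = if b 0 then -1 else 1 := by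
      intro b
      change ∏ i : Fin 2, (if b i then initialSign 2 1 i else 1) = _
      rw [Fin.prod_univ_two]
      simp [initialSign]
    simp only [hval] at hxy
    cases hx : x.1 0 <;> cases hy : y.1 0 <;> simp [hx, hy] at hxy ⊢ <;> norm_num at hxy

theorem exists_isEigenfunction_cocktailParty {n : ℕ} [DecidableRel (cocktailParty n).Adj]
    (hn : 2 ≤ n) (a : Fin n × Fin 2) :
    ∃ z z' : Fin n × Fin 2 → ℝ, (cocktailParty n).IsEigenfunction ((-2 : ℤ) : ℝ) z ∧
      (cocktailParty n).IsEigenfunction (((-2 : ℤ) : ℝ) + 2) z' ∧ z a ≠ 0 ∧ z' a ≠ 0 := by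
  have hn' : (2 : ℝ) ≤ n := by exact_mod_cast hn
  -- The first function sums to zero over the n pairs and equals n - 1 > 0 at `a`.
  refine ⟨fun x => (if x.1 = a.1 then (n : ℝ) else 0) - 1, fun x => if x.2 = 0 then 1 else -1,
    ?_, ?_, ?_, ?_⟩
  · push_cast
    exact isEigenfunction_cocktailParty_neg_two (f := fun i => (if i = a.1 then (n : ℝ) else 0) - 1)
      (by simp)
  · norm_num
    exact isEigenfunction_cocktailParty_zero
  · simp only [if_true]
    linarith
  · dsimp only
    split_ifs <;> norm_num

end QuantumWalk

theorem SimpleGraph.IsEigenfunction.exists_comp_iso {V V' : Type*} [Fintype V] [Fintype V']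
    {X : SimpleGraph V} {Y : SimpleGraph V'} [DecidableRel X.Adj] [DecidableRel Y.Adj] (φ : X ≃g Y)
    {θ θ' : ℝ}
    (h : ∀ a : V', ∃ z z' : V' → ℝ, Y.IsEigenfunction θ z ∧ Y.IsEigenfunction θ' z' ∧
      z a ≠ 0 ∧ z' a ≠ 0) (a : V) :
    ∃ z z' : V → ℝ, X.IsEigenfunction θ z ∧ X.IsEigenfunction θ' z' ∧ z a ≠ 0 ∧ z' a ≠ 0 := by
  obtain ⟨z, z', hz, hz', h1, h2⟩ := h (φ a)
  exact ⟨z ∘ φ, z' ∘ φ, hz.comp_iso φ, hz'.comp_iso φ, h1, h2⟩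

open QuantumWalk in
theorem mainTheorem10 {V W : Type*} [Fintype V] [DecidableEq V] [Fintype W] [DecidableEq W]
    [Nonempty W] (G : SimpleGraph V) [DecidableRel G.Adj] (H : SimpleGraph W) [DecidableRel H.Adj]
    (hG : (∃ d : ℕ, 2 ≤ d ∧ Nonempty (G ≃g QuantumWalk.hypercube d)) ∨
      (∃ n : ℕ, 2 ≤ n ∧ Nonempty (G ≃g QuantumWalk.cocktailParty n)) ∨
      (∃ d : ℕ, 1 ≤ d ∧ Nonempty (G ≃g QuantumWalk.halvedCube (2 * d))))
    (k : ℕ) (hH : H.IsRegularOfDegree k) :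
    ¬ QuantumWalk.HasPerfectStateTransfer (QuantumWalk.corona G H) := by
  classical
  intro h
  rcases hG with ⟨d, hd, ⟨φ⟩⟩ | ⟨n, hn, ⟨φ⟩⟩ | ⟨d, hd, ⟨φ⟩⟩
  · have := (eq_neg_one_of_hasPerfectStateTransfer_corona hH (lam := -d) (by omega)
      (SimpleGraph.IsEigenfunction.exists_comp_iso φ (exists_isEigenfunction_hypercube (by omega)))
      h).1
    omega
  · have := (eq_neg_one_of_hasPerfectStateTransfer_corona hH (lam := -2) (by omega)
      (SimpleGraph.IsEigenfunction.exists_comp_iso φ (exists_isEigenfunction_cocktailParty hn))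
      h).1
    omega
  · obtain ⟨h1, hk⟩ := eq_neg_one_of_hasPerfectStateTransfer_corona hH (lam := -d) (by omega)
      (SimpleGraph.IsEigenfunction.exists_comp_iso φ (exists_isEigenfunction_halvedCube hd)) h
    obtain rfl : d = 1 := by omega
    obtain ⟨z, hz, hone, hinj, hz0⟩ := exists_isEigenfunction_halvedCube_two
    exact not_hasPerfectStateTransfer_corona_of_degree_zero hH hk (hz.comp_iso φ)
      (hone.comp_iso φ) (hinj.comp φ.injective) (fun a => hz0 (φ a)) h
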